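/- Let $\mathbf H$ be the parity-check matrix of a QC-LDPC code: an $m_b\times n_b$ array of $p\times p$ binary blocks ($p\ge 1$), each of them zero or a circulant permutation matrix. Let $\mathcal S$ be a leafless elementary trapping set (LETS): a non-empty set of variable nodes such that every neighbouring check node of $\mathcal S$ has degree $1$ or $2$ in the subgraph of the Tanner graph induced by $\mathcal S$, and every variable node of $\mathcal S$ is adjacent to at least two check nodes of even induced degree (the missatisfied check nodes). The state variables of $\mathcal S$ are the messages $v\to c$ along the edges between variable nodes $v\in\mathcal S$ and missatisfied check nodes $c$. The flooding transition matrix $\mathbf A$ is the $0$-$1$ matrix, indexed by the state variables, whose entry in row $v\to c$ and column $v'\to c'$ is $1$ iff $c'\neq c$, $c'$ is adjacent to $v$, and $v'\neq v$. The row blocks of $\mathbf H$ are processed one after another, in some fixed order. Let $L_1,\dots,L_J$ be, in this order, the row blocks (layers) that contain missatisfied check nodes of $\mathcal S$. The state variable $v\to c$ is updated in the layer containing $c$, and $n_{L_j}$ is the number of state variables updated in $L_j$. Let $\mathcal A_j$ be the matrix whose rows belonging to the state variables of $L_j$ are those of $\mathbf A$ and whose other rows are those of the identity matrix, and let $\tilde{\mathbf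 A}_{J\to1}=\mathcal A_J\mathcal A_{J-1}\cdots\mathcal A_1$. The digraphs $D_f$ and $D_l$ have the state variables as nodes, with an edge from $x$ to $y$ iff the entry in row $y$ and column $x$ of $\mathbf A$, respectively of $\tilde{\mathbf A}_{J\to1}$, is non-zero. A square matrix $\mathbf M$ is reducible if for some permutation matrix $\mathbf P$ the matrix $\mathbf P\mathbf M\mathbf P^T$ is of the form $\begin{pmatrix}\mathbf M_a&\mathbf M_c\\ \mathbf 0&\mathbf M_b\end{pmatrix}$ with square blocks $\mathbf M_a,\mathbf M_b$ of positive size; a non-negative matrix that is not reducible is irreducible. A Frobenius normal form of $\mathbf M$ is a matrix $\mathbf P\mathbf M\mathbf P^T$, with $\mathbf P$ a permutation matrix, partitioned in block upper triangular form, such that each diagonal block is either irreducible or a $1\times1$ zero matrix. A $1\times 1$ zero block is not counted as an irreducible block. Then the following hold. 1. $\tilde{\mathbf A}_{J\to1}$ is non-negative and reducible. Moreover $J\ge1$, $n_{L_1}\ge 1$, and the first column block of $\tilde{\mathbf A}_{J\to1}$ (the columns of the $n_{L_1}$ state variables updated in $L_1$) is zero. 2. If a state variable $x$ is updated in $L_k$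 and all edges leaving $x$ in $D_f$ lead to state variables updated in layers $L_j$ with $j>k$, then $x$ has no outgoing edges in $D_l$. The number $n_z$ of nodes of $D_l$ without outgoing edges, i.e. of zero columns of $\tilde{\mathbf A}_{J\to1}$, satisfies $n_z\ge n_{L_1}$. 3. Suppose that $\mathbf A$ is irreducible. Then the digraph that remains when all nodes without outgoing edges, and their incoming edges, are removed from $D_l$ is strongly connected. Moreover $\tilde{\mathbf A}_{J\to1}$ has a Frobenius normal form, and every Frobenius normal form of $\tilde{\mathbf A}_{J\to1}$ has exactly one irreducible diagonal block, all its other diagonal blocks being $1\times1$ zero matrices. -/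

import Mathlib

namespace LETS

/-! ## Reducibility and the Frobenius normal form -/

section Frobenius

variable {ι : Type*}

/-- Some simultaneous permutation of the rows and columns (`P M Pᵀ`) brings `M` into the form
`[[M_a, M_c], [0, M_b]]`, with `M_a` and `M_b` square of sizes `k, l > 0`. -/
def IsReducible (M : Matrix ι ι ℝ) : Prop :=
  ∃ (k l : ℕ) (e : ι ≃ Fin k ⊕ Fin l), 0 < k ∧ 0 < l ∧ (M.reindex e e).toBlocks₂₁ = 0

/-- An irreducible non-negative matrix. By this definition every non-negative `1 × 1` matrix,
including the zero matrix, is irreducible. -/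
def IsIrreducible (M : Matrix ι ι ℝ) : Prop :=
  (∀ i j, 0 ≤ M i j) ∧ ¬ IsReducible M

/-- The `1 × 1` zero matrix. -/
def IsNullOne {d : ℕ} (M : Matrix (Fin d) (Fin d) ℝ) : Prop :=
  d = 1 ∧ M = 0

/-- The data of a simultaneous permutation of rows and columns, together with a partition of the
permuted index set into `t` consecutive non-empty blocks. -/
structure BlockPerm (ι : Type*) where
  /-- number of diagonal blocks -/
  t : ℕ
  /-- sizes of the diagonal blocks -/
  size : Fin t → ℕ
  size_pos : ∀ i, 0 < size i
  /-- the permutation -/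
  e : ι ≃ (i : Fin t) × Fin (size i)

/-- The `i`-th diagonal block of the permuted matrix. -/
def BlockPerm.block (F : BlockPerm ι) (M : Matrix ι ι ℝ) (i : Fin F.t) :
    Matrix (Fin (F.size i)) (Fin (F.size i)) ℝ :=
  (M.reindex F.e F.e).blockDiag' i

/-- `F` brings `M` into Frobenius normal form: the permuted matrix is block upper triangular and
each of its diagonal blocks is irreducible or a `1 × 1` zero matrix. -/
def BlockPerm.IsFrobeniusNormalForm (F : BlockPerm ι) (M : Matrix ι ι ℝ) : Prop :=
  (M.reindex F.e F.e).BlockTriangular Sigma.fst ∧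
    ∀ i, IsIrreducible (F.block M i) ∨ IsNullOne (F.block M i)

/-- The `i`-th diagonal block is one of the irreducible diagonal blocks, which are distinguished
from the `1 × 1` zero blocks. -/
def BlockPerm.IsIrreducibleBlock (F : BlockPerm ι) (M : Matrix ι ι ℝ) (i : Fin F.t) : Prop :=
  IsIrreducible (F.block M i) ∧ ¬ IsNullOne (F.block M i)

end Frobenius

/-! ## Digraphs of transition matrices -/

section Digraphs

variable {ι : Type*}

/-- The digraph of a transition matrix `M`: there is an edge from `x` to `y` when the new value of
`y` depends on the old value of `x`, so the adjacency matrix is (the support of) `Mᵀ`. -/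
def digraph (M : Matrix ι ι ℝ) : Digraph ι where
  Adj x y := M y x ≠ 0

/-- There is a directed walk between any two nodes. -/
def StronglyConnected (D : Digraph ι) : Prop :=
  ∀ x y, Relation.ReflTransGen D.Adj x y

/-- What is left of `D` when all nodes without outgoing edges (and their incoming edges) are
removed. -/
def removeSinks (D : Digraph ι) : Digraph {x : ι // ∃ y, D.Adj x y} where
  Adj x y := D.Adj x y

end Digraphs

/-! ## QC-LDPC codes and leafless elementary trapping sets -/

/-- Check nodes: (row block, row within the block). -/
abbrev CN (mb p : ℕ) := Fin mb × ZMod p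

/-- Variable nodes: (column block, column within the block). -/
abbrev VN (nb p : ℕ) := Fin nb × ZMod p

/-- `H` is an `mb × nb` array of `p × p` blocks, each of them zero or a circulant permutation
matrix. -/
def IsQC {mb nb p : ℕ} (H : Matrix (CN mb p) (VN nb p) (ZMod 2)) : Prop :=
  ∀ i j, (∀ r c, H (i, r) (j, c) = 0) ∨
    ∃ s : ZMod p, ∀ r c, H (i, r) (j, c) = if c = r + s then 1 else 0

section TrappingSets

variable {mb nb p : ℕ} (H : Matrix (CN mb p) (VN nb p) (ZMod 2)) (S : Finset (VN nb p))

/-- The degree of the check node `c` in the subgraph of the Tanner graph induced by `S`. -/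
def cnDegree (c : CN mb p) : ℕ := (S.filter fun v => H c v = 1).card

/-- A missatisfied check node: a neighbour of `S` that has even degree in the induced subgraph. -/
def IsMissatisfied (c : CN mb p) : Prop := 0 < cnDegree H S c ∧ Even (cnDegree H S c)

instance : DecidablePred (IsMissatisfied H S) := fun _ => inferInstanceAs (Decidable (_ ∧ _))

/-- State variables: the messages `v → c` on the edges of the induced subgraph from variable nodes
`v` of `S` to missatisfied check nodes `c`. -/
abbrev StateVar := {x : VN nb p × CN mb p // x.1 ∈ S ∧ IsMissatisfied H S x.2 ∧ H x.2 x.1 = 1}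

/-- The transition matrix `A` of the flooding schedule: the new message `v → c` is the sum of the
old messages `v' → c'` over the missatisfied check nodes `c' ≠ c` adjacent to `v`, where `v'` is a
neighbour of `c'` in `S` other than `v`. -/
def floodingMatrix : Matrix (StateVar H S) (StateVar H S) ℝ :=
  Matrix.of fun x y => if y.1.2 ≠ x.1.2 ∧ H y.1.2 x.1.1 = 1 ∧ y.1.1 ≠ x.1.1 then 1 else 0

variable [NeZero p]

/-- `S` is a leafless elementary trapping set: it is non-empty, every check node has degree `0`
(no neighbour in `S`), `1` or `2` in the induced subgraph, and every variable node of `S` is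
connected to at least two missatisfied check nodes. -/
structure IsLETS : Prop where
  nonempty : S.Nonempty
  elementary : ∀ c : CN mb p, cnDegree H S c ≤ 2
  leafless : ∀ v ∈ S, 2 ≤ (Finset.univ.filter fun c => IsMissatisfied H S c ∧ H c v = 1).card

/-! ## The row layered schedule

In every iteration the row blocks of `H` are processed one after another; `π z` is the position at
which row block `z` is processed. -/

variable (π : Equiv.Perm (Fin mb))

/-- The positions of the row blocks that contain missatisfied check nodes of `S`. -/
def layers : Finset (Fin mb) :=
  (Finset.univ.filter fun c => IsMissatisfied H S c).image fun c => π c.1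

/-- The number `J` of layers of `S`. -/
def numLayers : ℕ := (layers H S π).card

lemma mem_layers (x : StateVar H S) : π x.1.2.1 ∈ layers H S π :=
  Finset.mem_image.2 ⟨x.1.2, Finset.mem_filter.2 ⟨Finset.mem_univ _, x.2.2.1⟩, rfl⟩

/-- The layer in which the state variable `x` is updated. The layers are numbered `0, …, J - 1` in
the order in which they are processed. -/
def layer (x : StateVar H S) : Fin (numLayers H S π) :=
  ((layers H S π).orderIsoOfFin rfl).symm ⟨π x.1.2.1, mem_layers H S π x⟩

/-- The number of state variables that are updated in layer `j`. -/
noncomputable def layerSize (j : Fin (numLayers H S π)) : ℕ :=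
  Nat.card {x : StateVar H S // layer H S π x = j}

/-- The transition matrix of layer `j`: the rows of the state variables updated in layer `j` are
those of the flooding matrix, all other rows are those of the identity matrix. -/
def layerMatrix (j : Fin (numLayers H S π)) : Matrix (StateVar H S) (StateVar H S) ℝ :=
  Matrix.of fun x y =>
    if layer H S π x = j then floodingMatrix H S x y else (1 : Matrix _ _ ℝ) x y

/-- The transition matrix of the layered decoder: the product of the transition matrices of the
layers, from the last layer (leftmost factor) to the first one (rightmost factor). -/
def layeredMatrix : Matrix (StateVar H S) (StateVar H S) ℝ :=
  ((List.ofFn (layerMatrix H S π)).reverse).prod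

/-- The number `n_z` of zero columns of the transition matrix of the layered decoder. -/
noncomputable def numZeroColumns : ℕ :=
  Nat.card {y : StateVar H S // ∀ x, layeredMatrix H S π x y = 0}

end TrappingSets

end LETS

namespace LETS

/-! ### Reducibility in terms of closed sets of nodes -/

section Reducibility

variable {ι : Type*}

/-! Row `x` of the layered matrix `M` is row `x` of the flooding matrix `A` with every input from an
earlier layer replaced by its already updated value (`layered_prod_apply`). Nothing cancels, as all
entries are non-negative, so an edge of `D_l` is a walk of `D_f` whose first step goes to a layer
that is not later and whose other steps go to strictly later layers. The circulant structure
excludes steps within a layer. Hence a node whose `D_f`-successors all lie in later layers, in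
particular any node of the first layer, is a sink of `D_l`; its zero column makes `M` reducible. If
`D_f` is strongly connected, a walk of `D_f` between non-sinks of `D_l`, cut at its descending
steps, becomes a walk of `D_l` through non-sinks (`transGen_removeSinks`). So the non-sinks form a
single class, while every sink contributes a `1 × 1` zero block. -/

lemma isReducible_iff_exists_set [Finite ι] {M : Matrix ι ι ℝ} :
    IsReducible M ↔
      ∃ C : Set ι, C.Nonempty ∧ Cᶜ.Nonempty ∧ ∀ x ∈ C, ∀ y ∉ C, M y x = 0 := by
  classical
  constructor
  · rintro ⟨k, l, e, hk, hl, h⟩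
    refine ⟨{x | (e x).isLeft}, ⟨e.symm (Sum.inl ⟨0, hk⟩), by simp⟩,
      ⟨e.symm (Sum.inr ⟨0, hl⟩), by simp⟩, fun x hx y hy => ?_⟩
    obtain ⟨a, ha⟩ := Sum.isLeft_iff.1 hx
    obtain ⟨b, hb⟩ := Sum.isRight_iff.1 (Sum.not_isLeft.1 hy)
    have := congrFun (congrFun h b) a
    simpa [Matrix.toBlocks₂₁, ← ha, ← hb] using this
  · rintro ⟨C, ⟨x, hx⟩, ⟨y, hy⟩, h⟩
    have : Nonempty C := ⟨⟨x, hx⟩⟩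
    have : Nonempty {z // z ∉ C} := ⟨⟨y, hy⟩⟩
    refine ⟨Nat.card C, Nat.card {z // z ∉ C},
      (Equiv.sumCompl (· ∈ C)).symm.trans
        (Equiv.sumCongr (Finite.equivFin C) (Finite.equivFin {z // z ∉ C})),
      Nat.card_pos, Nat.card_pos, ?_⟩
    ext b a
    exact
      h _ ((Finite.equivFin C).symm a).2 _ ((Finite.equivFin {z // z ∉ C}).symm b).2

lemma IsReducible.of_zero_column [Finite ι] [Nontrivial ι] {M : Matrix ι ι ℝ} {x : ι}
    (h : ∀ y, M y x = 0) : IsReducible M := by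
  obtain ⟨y, hy⟩ := exists_ne x
  exact isReducible_iff_exists_set.2
    ⟨{x}, ⟨x, rfl⟩, ⟨y, hy⟩, fun z hz w _ => by rw [Set.mem_singleton_iff.1 hz]; exact h w⟩

/-- The set of nodes reachable from `x` has no outgoing edges, so if it missed a node it would
witness reducibility. -/
lemma IsIrreducible.stronglyConnected [Finite ι] {M : Matrix ι ι ℝ} (h : IsIrreducible M) :
    StronglyConnected (digraph M) := by
  intro x y
  by_contra hxy
  refine h.2 (isReducible_iff_exists_set.2
    ⟨{z | Relation.ReflTransGen (digraph M).Adj x z}, ⟨x, .refl⟩, ⟨y, hxy⟩, ?_⟩)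
  intro z hz w hw
  by_contra hne
  exact hw (Relation.ReflTransGen.tail hz hne)

lemma IsIrreducible.exists_ne_zero {d : ℕ} {M : Matrix (Fin d) (Fin d) ℝ} (h : IsIrreducible M)
    (h' : ¬ IsNullOne M) (x : Fin d) : ∃ y, M y x ≠ 0 := by
  by_contra! hx
  rcases subsingleton_or_nontrivial (Fin d) with hd | hd
  · refine h' ⟨?_, ?_⟩
    · have := Fin.subsingleton_iff_le_one.1 hd
      have := x.pos
      omega
    · ext a b
      rw [Subsingleton.elim b x]
      exact hx a
  · exact h.2 (.of_zero_column hx)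

lemma reflTransGen_mem_of_closed {r : ι → ι → Prop} {C : Set ι}
    (hC : ∀ x ∈ C, ∀ y, r x y → y ∈ C) {x y : ι} (hx : x ∈ C)
    (h : Relation.ReflTransGen r x y) : y ∈ C := by
  induction h with
  | refl => exact hx
  | tail _ hr ih => exact hC _ ih _ hr

end Reducibility

/-! ### Frobenius normal forms when the non-sinks are strongly connected -/

section FrobeniusNormalForm

variable {ι : Type*}

/-- The block permutation whose blocks are the fibres of a surjective map. -/
noncomputable def BlockPerm.ofFibers [Finite ι] {t : ℕ} (f : ι → Fin t)
    (hf : Function.Surjective f) : BlockPerm ι where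
  t := t
  size i := Nat.card {x // f x = i}
  size_pos i := by
    obtain ⟨x, hx⟩ := hf i
    have : Nonempty {x // f x = i} := ⟨⟨x, hx⟩⟩
    exact Nat.card_pos
  e := (Equiv.sigmaFiberEquiv f).symm.trans (Equiv.sigmaCongrRight fun _ => Finite.equivFin _)

lemma BlockPerm.ofFibers_e_fst [Finite ι] {t : ℕ} (f : ι → Fin t)
    (hf : Function.Surjective f) (x : ι) : ((ofFibers f hf).e x).1 = f x := rfl

lemma BlockPerm.block_apply (F : BlockPerm ι) (M : Matrix ι ι ℝ) (i : Fin F.t)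
    (a b : Fin (F.size i)) : F.block M i a b = M (F.e.symm ⟨i, a⟩) (F.e.symm ⟨i, b⟩) := rfl

lemma BlockPerm.fst_le_of_ne_zero {F : BlockPerm ι} {M : Matrix ι ι ℝ}
    (h : (M.reindex F.e F.e).BlockTriangular Sigma.fst) {x y : ι} (hxy : M y x ≠ 0) :
    (F.e y).1 ≤ (F.e x).1 := by
  by_contra! hlt
  exact hxy (by simpa using h hlt)

lemma BlockPerm.exists_eq_symm_of_fst_eq {F : BlockPerm ι} {x : ι} {i : Fin F.t}
    (h : (F.e x).1 = i) : ∃ a, x = F.e.symm ⟨i, a⟩ := by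
  subst h
  exact ⟨(F.e x).2, (F.e.symm_apply_apply x).symm⟩

variable {M : Matrix ι ι ℝ}

/-- In a Frobenius normal form, the non-sinks form one block if they are connected. -/
lemma BlockPerm.IsFrobeniusNormalForm.existsUnique_block
    (hne : ∃ x y, (digraph M).Adj x y)
    (hM : ∀ x y, Relation.TransGen (removeSinks (digraph M)).Adj x y)
    {F : BlockPerm ι} (hF : F.IsFrobeniusNormalForm M) :
    ∃! i : Fin F.t, F.IsIrreducibleBlock M i ∧ ∀ k, k ≠ i → IsNullOne (F.block M k) := by
  obtain ⟨x₀, y₀, h₀⟩ := hne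
  -- Edges never raise the block index, so mutually reachable non-sinks share one block.
  have hle : ∀ x y : {x // ∃ y, (digraph M).Adj x y}, (F.e y).1 ≤ (F.e x).1 := fun x y =>
    reflTransGen_mem_of_closed (C := {y : {x // ∃ y, (digraph M).Adj x y} | (F.e y.1).1 ≤ (F.e x.1).1})
      (r := (removeSinks (digraph M)).Adj) (fun a ha b hab => (fst_le_of_ne_zero hF.1 hab).trans ha)
      (show x ∈ _ from le_refl (F.e x.1).1) (hM x y).to_reflTransGen
  have key : ∀ k, ¬ IsNullOne (F.block M k) → k = (F.e x₀).1 := by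
    intro k hk
    have hirr := (hF.2 k).resolve_right hk
    obtain ⟨b, hb⟩ := hirr.exists_ne_zero hk ⟨0, F.size_pos k⟩
    have hb' : (digraph M).Adj (F.e.symm ⟨k, ⟨0, F.size_pos k⟩⟩) (F.e.symm ⟨k, b⟩) := hb
    have h1 := hle ⟨_, _, hb'⟩ ⟨x₀, y₀, h₀⟩
    have h2 := hle ⟨x₀, y₀, h₀⟩ ⟨_, _, hb'⟩
    simp only [Equiv.apply_symm_apply] at h1 h2
    exact le_antisymm h2 h1
  -- Here `TransGen` matters: `x₀` lies on a closed walk of positive length inside its block, which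
  -- in a `1 × 1` block forces a non-zero diagonal entry.
  have hnn : ¬ IsNullOne (F.block M (F.e x₀).1) := by
    rintro ⟨h1, h2⟩
    obtain ⟨z, hz, -⟩ := Relation.TransGen.head'_iff.1 (hM ⟨x₀, y₀, h₀⟩ ⟨x₀, y₀, h₀⟩)
    have hz' : M z.1 x₀ ≠ 0 := hz
    have hfst : (F.e z.1).1 = (F.e x₀).1 := le_antisymm (hle ⟨x₀, y₀, h₀⟩ z) (hle z ⟨x₀, y₀, h₀⟩)
    have hsub : Subsingleton (Fin (F.size (F.e x₀).1)) := Fin.subsingleton_iff_le_one.2 h1.le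
    have hzx : F.e z.1 = F.e x₀ := by
      obtain ⟨a, ha⟩ := exists_eq_symm_of_fst_eq hfst
      rw [ha, Equiv.apply_symm_apply, Subsingleton.elim a (F.e x₀).2]
    rw [F.e.injective hzx] at hz'
    have := congrFun (congrFun h2 (F.e x₀).2) (F.e x₀).2
    rw [block_apply] at this
    simp only [Sigma.eta, Equiv.symm_apply_apply] at this
    exact hz' this
  refine ⟨(F.e x₀).1, ⟨⟨(hF.2 _).resolve_right hnn, hnn⟩, fun k hk => ?_⟩, fun i hi => ?_⟩
  · by_contra h
    exact hk (key k h)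
  · exact key i hi.1.2

lemma exists_isFrobeniusNormalForm [Finite ι] (h0 : ∀ x y, 0 ≤ M x y)
    (hne : ∃ x y, (digraph M).Adj x y)
    (hM : StronglyConnected (removeSinks (digraph M))) :
    ∃ F : BlockPerm ι, F.IsFrobeniusNormalForm M := by
  classical
  obtain ⟨x₀, hx₀⟩ := hne
  let s := Finite.equivFin {x // ¬ ∃ y, (digraph M).Adj x y}
  -- One singleton block per sink, with all non-sinks in the last block: edges start only at
  -- non-sinks, so this is upper triangular.
  let f : ι → Fin (Nat.card {x // ¬ ∃ y, (digraph M).Adj x y} + 1) := fun x =>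
    if h : ∃ y, (digraph M).Adj x y then Fin.last _ else (s ⟨x, h⟩).castSucc
  have hf1 : ∀ x, (∃ y, (digraph M).Adj x y) → f x = Fin.last _ := fun x h => dif_pos h
  have hf2 : ∀ x (h : ¬ ∃ y, (digraph M).Adj x y), f x = (s ⟨x, h⟩).castSucc :=
    fun x h => dif_neg h
  have hf : Function.Surjective f := by
    intro i
    induction i using Fin.lastCases with
    | last => exact ⟨x₀, hf1 _ hx₀⟩
    | cast i => exact ⟨(s.symm i).1, by rw [hf2 _ (s.symm i).2]; simp⟩
  let F := BlockPerm.ofFibers f hf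
  have hFe : ∀ x, (F.e x).1 = f x := BlockPerm.ofFibers_e_fst f hf
  refine ⟨F, ?_, fun i => ?_⟩
  · intro a b hab
    obtain ⟨x, rfl⟩ := F.e.surjective a
    obtain ⟨y, rfl⟩ := F.e.surjective b
    rw [hFe, hFe] at hab
    by_contra h
    have hxy : M x y ≠ 0 := by simpa using h
    rw [hf1 y ⟨x, hxy⟩] at hab
    exact absurd hab (Fin.le_last _).not_gt
  · have hfs : ∀ a, f (F.e.symm ⟨i, a⟩) = i := fun a => by rw [← hFe, Equiv.apply_symm_apply]
    by_cases hi : i = Fin.last _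
    · left
      refine ⟨fun a b => h0 _ _, fun hred => ?_⟩
      obtain ⟨C, ⟨a, ha⟩, ⟨b, hb⟩, hC⟩ := isReducible_iff_exists_set.1 hred
      have hns : ∀ c, ∃ y, (digraph M).Adj (F.e.symm ⟨i, c⟩) y := by
        intro c
        by_contra hc
        have := (hfs c).symm.trans (hf2 _ hc)
        exact (Fin.castSucc_lt_last _).ne (this.symm.trans hi)
      -- A closed proper part of the last block would trap walks between non-sinks.
      have hmem := reflTransGen_mem_of_closed
        (C := {x : {x // ∃ y, (digraph M).Adj x y} | ∃ c ∈ C, x.1 = F.e.symm ⟨i, c⟩})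
        (r := (removeSinks (digraph M)).Adj) ?_ (x := ⟨_, hns a⟩) (y := ⟨_, hns b⟩) ⟨a, ha, rfl⟩
        (hM _ _)
      · obtain ⟨c, hc, hbc⟩ := hmem
        have hbc' := F.e.symm.injective hbc
        simp only [Sigma.mk.injEq, heq_eq_eq, true_and] at hbc'
        exact hb (hbc' ▸ hc)
      · rintro ⟨x, hx⟩ ⟨c, hc, hxc⟩ ⟨y, hy⟩ hxy
        have hxy' : M y x ≠ 0 := hxy
        dsimp only at hxc
        obtain ⟨d, rfl⟩ : ∃ d, y = F.e.symm ⟨i, d⟩ :=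
          BlockPerm.exists_eq_symm_of_fst_eq
            ((hFe y).trans ((hf1 y hy).trans hi.symm))
        refine ⟨d, ?_, rfl⟩
        by_contra hd
        exact hxy' (hxc ▸ hC c hc d hd)
    · right
      have hns : ∀ c, ¬ ∃ y, (digraph M).Adj (F.e.symm ⟨i, c⟩) y := fun c hc =>
        hi ((hfs c).symm.trans (hf1 _ hc))
      have hsub : Subsingleton (Fin (F.size i)) := by
        refine ⟨fun a b => ?_⟩
        have hab := (hfs a).trans (hfs b).symm
        rw [hf2 _ (hns a), hf2 _ (hns b)] at hab
        have hab' := F.e.symm.injective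
          (Subtype.mk.inj (s.injective (Fin.castSucc_injective _ hab)))
        simpa using hab'
      refine ⟨le_antisymm (Fin.subsingleton_iff_le_one.1 hsub) (F.size_pos i), ?_⟩
      ext a b
      by_contra h
      exact hns b ⟨_, h⟩

end FrobeniusNormalForm

/-! ### Layered updates as substitution, and walks in the two digraphs -/

section LayeredUpdate

variable {ι : Type*} [Fintype ι] [DecidableEq ι]

/-- The product of the single-layer updates is determined by substitution: layer by layer, the
inputs from earlier layers are replaced by their updated values. -/
lemma layered_prod_apply {J : ℕ} (ℓ : ι → Fin J) (A : Matrix ι ι ℝ) (B : Fin J → Matrix ι ι ℝ)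
    (hB : ∀ j x y, B j x y = if ℓ x = j then A x y else (1 : Matrix ι ι ℝ) x y) (x y : ι) :
    (List.ofFn B).reverse.prod x y =
      ∑ z, A x z *
        (if ℓ z < ℓ x then (List.ofFn B).reverse.prod z y else (1 : Matrix ι ι ℝ) z y) := by
  -- `P k` is the state after the first `k` layers; row `x` changes only in passing from `P (ℓ x)`
  -- to `P (ℓ x + 1)`.
  let P : ℕ → Matrix ι ι ℝ := fun k => ((List.ofFn B).take k).reverse.prod
  have hPJ : (List.ofFn B).reverse.prod = P J := by
    simp only [P]
    rw [List.take_of_length_le (by simp)]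
  have hP : ∀ k (hk : k < J), P (k + 1) = B ⟨k, hk⟩ * P k := by
    intro k hk
    simp only [P]
    rw [List.take_succ_eq_append_getElem (by simpa using hk)]
    simp
  have hrow : ∀ k (hk : k < J) (x : ι), (ℓ x : ℕ) ≠ k → ∀ y, P (k + 1) x y = P k x y := by
    intro k hk x hx y
    have hx' : ℓ x ≠ ⟨k, hk⟩ := fun h => hx (congrArg Fin.val h)
    rw [hP k hk, Matrix.mul_apply]
    simp [hB, hx', Matrix.one_apply]
  have hbefore : ∀ k ≤ J, ∀ x, k ≤ ℓ x → ∀ y, P k x y = (1 : Matrix ι ι ℝ) x y := by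
    intro k
    induction k with
    | zero => intro _ x _ y; simp [P]
    | succ k ih =>
      intro hk x hx y
      rw [hrow k hk x (by omega), ih (by omega) x (by omega)]
  have hafter : ∀ x y k, (ℓ x : ℕ) + 1 ≤ k → k ≤ J → P k x y = P (ℓ x + 1) x y := by
    intro x y k hk
    induction k, hk using Nat.le_induction with
    | base => intro _; rfl
    | succ k hk ih => intro hkJ; rw [hrow k hkJ x (by omega), ih (by omega)]
  rw [hPJ, hafter x y J (ℓ x).2 le_rfl, hP _ (ℓ x).2, Matrix.mul_apply]
  refine Finset.sum_congr rfl fun z _ => ?_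
  rw [hB, if_pos rfl]
  congr 1
  split_ifs with h
  · rw [hafter z y (ℓ x) h (ℓ x).2.le, hafter z y J (ℓ z).2 le_rfl]
  · exact hbefore _ (ℓ x).2.le z (not_lt.1 h) y

variable {κ : Type*} [LinearOrder κ] [Finite κ] {ℓ : ι → κ} {A M : Matrix ι ι ℝ}

/-- `M` describes one iteration of the updates `A`, carried out in the order given by `ℓ`. -/
def IsLayeredUpdate (ℓ : ι → κ) (A M : Matrix ι ι ℝ) : Prop :=
  ∀ x y, M x y = ∑ z, A x z * (if ℓ z < ℓ x then M z y else (1 : Matrix ι ι ℝ) z y)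

namespace IsLayeredUpdate

lemma nonneg (h : IsLayeredUpdate ℓ A M) (hA : ∀ x y, 0 ≤ A x y) (x y : ι) : 0 ≤ M x y := by
  induction hk : ℓ x using WellFoundedLT.induction generalizing x with
  | ind k ih =>
    rw [h x y]
    refine Finset.sum_nonneg fun z _ => mul_nonneg (hA x z) ?_
    split_ifs with hz
    · exact ih _ (hk ▸ hz) z rfl
    · rw [Matrix.one_apply]
      split_ifs <;> norm_num

lemma ne_zero_of_term (h : IsLayeredUpdate ℓ A M) (hA : ∀ x y, 0 ≤ A x y) {x y z : ι}
    (hxz : A x z ≠ 0)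
    (hz : (if ℓ z < ℓ x then M z y else (1 : Matrix ι ι ℝ) z y) ≠ 0) : M x y ≠ 0 := by
  have hterm : ∀ w, 0 ≤ (if ℓ w < ℓ x then M w y else (1 : Matrix ι ι ℝ) w y) := by
    intro w
    split_ifs
    · exact h.nonneg hA w y
    · rw [Matrix.one_apply]
      split_ifs <;> norm_num
  rw [h x y]
  refine (Finset.sum_pos' (fun w _ => mul_nonneg (hA x w) (hterm w))
    ⟨z, Finset.mem_univ z, mul_pos ((hA x z).lt_of_ne' hxz) ((hterm z).lt_of_ne' hz)⟩).ne'

lemma ne_zero_of_lt (h : IsLayeredUpdate ℓ A M) (hA : ∀ x y, 0 ≤ A x y) {x y : ι}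
    (hxy : A x y ≠ 0) (hlt : ℓ x < ℓ y) : M x y ≠ 0 :=
  h.ne_zero_of_term hA hxy (by simp [hlt.not_gt])

lemma ne_zero_trans (h : IsLayeredUpdate ℓ A M) (hA : ∀ x y, 0 ≤ A x y) {x y z : ι}
    (hxz : A x z ≠ 0) (hlt : ℓ z < ℓ x) (hzy : M z y ≠ 0) : M x y ≠ 0 :=
  h.ne_zero_of_term hA hxz (by rwa [if_pos hlt])

/-- Unfolding the recursion from `x` ends at an identity term, where some `z` reads the old value of
`y`; this happens only if `y` is not updated before `z`. -/
lemma exists_le_of_ne_zero (h : IsLayeredUpdate ℓ A M) {x y : ι} (hxy : M x y ≠ 0) :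
    ∃ z, A z y ≠ 0 ∧ ℓ z ≤ ℓ y := by
  induction hk : ℓ x using WellFoundedLT.induction generalizing x with
  | ind k ih =>
    rw [h x y] at hxy
    obtain ⟨z, -, hz⟩ := Finset.exists_ne_zero_of_sum_ne_zero hxy
    have hxz := left_ne_zero_of_mul hz
    have hz' := right_ne_zero_of_mul hz
    split_ifs at hz' with hlt
    · exact ih _ (hk ▸ hlt) hz' rfl
    · obtain rfl : z = y := by
        by_contra hne
        exact hz' (Matrix.one_apply_ne hne)
      exact ⟨x, hxz, not_lt.1 hlt⟩

/-- A walk of the flooding digraph, cut at the steps that go to an earlier layer, is a walk of the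
layered digraph. -/
lemma transGen_removeSinks (h : IsLayeredUpdate ℓ A M) (hA : ∀ x y, 0 ≤ A x y)
    (hℓ : ∀ x y, A x y ≠ 0 → ℓ x ≠ ℓ y) {w : ι} (y : {x // ∃ y, (digraph M).Adj x y})
    (hwy : Relation.ReflTransGen (digraph A).Adj w y) :
    ∀ x : {x // ∃ y, (digraph M).Adj x y}, M w x ≠ 0 →
      Relation.TransGen (removeSinks (digraph M)).Adj x y := by
  induction hwy using Relation.ReflTransGen.head_induction_on with
  | refl => exact fun x hx => .single hx
  | @head w w' hww' _ ih =>
    intro x hx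
    rcases lt_or_gt_of_ne (hℓ w' w hww') with hlt | hlt
    -- Descending step: `w` is a non-sink, so the edge from `x` to `w` is complete and a new one
    -- starts at `w`.
    · have hadj : (digraph M).Adj w w' := h.ne_zero_of_lt hA hww' hlt
      have hxw : (removeSinks (digraph M)).Adj x ⟨w, w', hadj⟩ := hx
      exact .head hxw (ih ⟨w, w', hadj⟩ hadj)
    -- Ascending step: `w'` uses the updated value of `w`, which extends the current edge from `x`.
    · exact ih x (h.ne_zero_trans hA hww' hlt hx)

lemma transGen_of_stronglyConnected (h : IsLayeredUpdate ℓ A M) (hA : ∀ x y, 0 ≤ A x y)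
    (hℓ : ∀ x y, A x y ≠ 0 → ℓ x ≠ ℓ y) (hconn : StronglyConnected (digraph A))
    (x y : {x // ∃ y, (digraph M).Adj x y}) :
    Relation.TransGen (removeSinks (digraph M)).Adj x y := by
  obtain ⟨w, hw⟩ := x.2
  exact h.transGen_removeSinks hA hℓ y (hconn w y) x hw

/-- A node of maximal layer has an outgoing edge in the flooding digraph, and that edge can only
descend. -/
lemma exists_adj [Nontrivial ι] (h : IsLayeredUpdate ℓ A M) (hA : ∀ x y, 0 ≤ A x y)
    (hℓ : ∀ x y, A x y ≠ 0 → ℓ x ≠ ℓ y) (hconn : StronglyConnected (digraph A)) :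
    ∃ x y, (digraph M).Adj x y := by
  obtain ⟨x, hx⟩ := Finite.exists_max ℓ
  obtain ⟨y, hy⟩ := exists_ne x
  rcases Relation.ReflTransGen.cases_head (hconn x y) with rfl | ⟨z, hz, -⟩
  · exact absurd rfl hy
  · exact ⟨x, z, h.ne_zero_of_lt hA hz ((hx z).lt_of_ne (hℓ z x hz))⟩


end IsLayeredUpdate

end LayeredUpdate

/-! ### Application to trapping sets of QC-LDPC codes -/

section TrappingSets

variable {mb nb p : ℕ} {H : Matrix (CN mb p) (VN nb p) (ZMod 2)} {S : Finset (VN nb p)}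

/-- In a parity-check matrix of a QC-LDPC code, a variable node has at most one neighbour in every
row block. -/
lemma IsQC.eq_of_fst_eq (hH : IsQC H) {c c' : CN mb p} {v : VN nb p} (hc : H c v = 1)
    (hc' : H c' v = 1) (h : c.1 = c'.1) : c = c' := by
  obtain ⟨i, r⟩ := c
  obtain ⟨i', r'⟩ := c'
  obtain ⟨j, k⟩ := v
  obtain rfl : i = i' := h
  rcases hH i j with h0 | ⟨s, hs⟩
  · simp [h0] at hc
  · have h1 : k = r + s := by
      by_contra hne
      simp [hs, hne] at hc
    have h2 : k = r' + s := by
      by_contra hne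
      simp [hs, hne] at hc'
    rw [add_right_cancel (h1.symm.trans h2)]

lemma floodingMatrix_nonneg (x y : StateVar H S) : 0 ≤ floodingMatrix H S x y := by
  rw [floodingMatrix, Matrix.of_apply]
  split_ifs <;> norm_num

variable [NeZero p] {π : Equiv.Perm (Fin mb)}

lemma fst_eq_of_layer_eq {x y : StateVar H S} (h : layer H S π x = layer H S π y) :
    x.1.2.1 = y.1.2.1 := by
  have h' := ((layers H S π).orderIsoOfFin rfl).symm.injective h
  exact π.injective (congrArg Subtype.val h')

/-- The two check nodes are distinct neighbours of the variable node of `x`, so they lie in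
different row blocks. -/
lemma layer_ne_of_floodingMatrix_ne_zero (hH : IsQC H) {x y : StateVar H S}
    (h : floodingMatrix H S x y ≠ 0) : layer H S π x ≠ layer H S π y := by
  intro hl
  rw [floodingMatrix, Matrix.of_apply] at h
  split_ifs at h with hxy
  · exact hxy.1 (hH.eq_of_fst_eq hxy.2.1 x.2.2.2 (fst_eq_of_layer_eq hl).symm)
  · exact h rfl

lemma exists_layer_eq (j : Fin (numLayers H S π)) : ∃ x : StateVar H S, layer H S π x = j := by
  obtain ⟨z, hz⟩ : ∃ z, z = (layers H S π).orderIsoOfFin rfl j := ⟨_, rfl⟩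
  obtain ⟨c, hc, hcz⟩ := Finset.mem_image.1 z.2
  have hmis := (Finset.mem_filter.1 hc).2
  obtain ⟨v, hv⟩ := Finset.card_pos.1 hmis.1
  rw [Finset.mem_filter] at hv
  refine ⟨⟨(v, c), hv.1, hmis, hv.2⟩, ?_⟩
  exact (OrderIso.symm_apply_eq _).2 (hz ▸ Subtype.ext hcz)

lemma IsLETS.nontrivial_stateVar (hS : IsLETS H S) : Nontrivial (StateVar H S) := by
  obtain ⟨v, hv⟩ := hS.nonempty
  obtain ⟨c, hc, c', hc', hne⟩ := Finset.one_lt_card.1 (hS.leafless v hv)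
  rw [Finset.mem_filter] at hc hc'
  exact ⟨⟨(v, c), hv, hc.2⟩, ⟨(v, c'), hv, hc'.2⟩, fun h => hne (by simpa using h)⟩

lemma isLayeredUpdate_layeredMatrix :
    IsLayeredUpdate (layer H S π) (floodingMatrix H S) (layeredMatrix H S π) :=
  layered_prod_apply _ _ _ fun _ _ _ => rfl

lemma layeredMatrix_eq_zero {x : StateVar H S}
    (hx : ∀ y, (digraph (floodingMatrix H S)).Adj x y → layer H S π x < layer H S π y)
    (y : StateVar H S) : layeredMatrix H S π y x = 0 := by
  by_contra h
  obtain ⟨z, hz, hle⟩ := isLayeredUpdate_layeredMatrix.exists_le_of_ne_zero h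
  exact (hx z hz).not_ge hle

lemma layeredMatrix_eq_zero_of_first_layer (hH : IsQC H) (hJ : 0 < numLayers H S π)
    {x : StateVar H S} (hx : layer H S π x = ⟨0, hJ⟩) (y : StateVar H S) :
    layeredMatrix H S π y x = 0 := by
  refine layeredMatrix_eq_zero (fun z hz => ?_) y
  refine lt_of_le_of_ne ?_ (layer_ne_of_floodingMatrix_ne_zero hH hz).symm
  rw [hx, Fin.le_def]
  exact Nat.zero_le _

end TrappingSets

end LETS

theorem mainTheorem3 {mb nb p : ℕ} [NeZero p]
    (H : Matrix (LETS.CN mb p) (LETS.VN nb p) (ZMod 2)) (hH : LETS.IsQC H)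
    (π : Equiv.Perm (Fin mb)) (S : Finset (LETS.VN nb p)) (hS : LETS.IsLETS H S) :
    -- the layered transition matrix is non-negative and reducible
    ((∀ x y, 0 ≤ LETS.layeredMatrix H S π x y) ∧
      LETS.IsReducible (LETS.layeredMatrix H S π)) ∧
    -- there is a first layer; its column block is zero, and `n_z` is at least its size
    (∃ hJ : 0 < LETS.numLayers H S π,
      0 < LETS.layerSize H S π ⟨0, hJ⟩ ∧
      (∀ x y, LETS.layer H S π y = ⟨0, hJ⟩ → LETS.layeredMatrix H S π x y = 0) ∧
      LETS.layerSize H S π ⟨0, hJ⟩ ≤ LETS.numZeroColumns H S π) ∧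
    -- nodes all of whose children in the flooding digraph are updated in later layers
    (∀ x, (∀ y, (LETS.digraph (LETS.floodingMatrix H S)).Adj x y →
        LETS.layer H S π x < LETS.layer H S π y) →
      ∀ y, ¬ (LETS.digraph (LETS.layeredMatrix H S π)).Adj x y) ∧
    -- the case of an irreducible flooding matrix
    (LETS.IsIrreducible (LETS.floodingMatrix H S) →
      LETS.StronglyConnected (LETS.removeSinks (LETS.digraph (LETS.layeredMatrix H S π))) ∧
      (∃ F : LETS.BlockPerm (LETS.StateVar H S),
        F.IsFrobeniusNormalForm (LETS.layeredMatrix H S π)) ∧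
      ∀ F : LETS.BlockPerm (LETS.StateVar H S),
        F.IsFrobeniusNormalForm (LETS.layeredMatrix H S π) →
        ∃! i : Fin F.t, F.IsIrreducibleBlock (LETS.layeredMatrix H S π) i ∧
          ∀ k, k ≠ i → LETS.IsNullOne (F.block (LETS.layeredMatrix H S π) k)) := by
  have hnt := hS.nontrivial_stateVar
  have hM := LETS.isLayeredUpdate_layeredMatrix (H := H) (S := S) (π := π)
  have hA := LETS.floodingMatrix_nonneg (H := H) (S := S)
  have hℓ : ∀ x y, LETS.floodingMatrix H S x y ≠ 0 → LETS.layer H S π x ≠ LETS.layer H S π y :=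
    fun _ _ => LETS.layer_ne_of_floodingMatrix_ne_zero hH
  have hJ : 0 < LETS.numLayers H S π := by
    obtain ⟨x⟩ := hnt.to_nonempty
    exact (LETS.layer H S π x).pos
  obtain ⟨x₀, hx₀⟩ := LETS.exists_layer_eq (H := H) (S := S) (π := π) ⟨0, hJ⟩
  refine ⟨⟨hM.nonneg hA, .of_zero_column
      (LETS.layeredMatrix_eq_zero_of_first_layer hH hJ hx₀)⟩, ⟨hJ, ?_, ?_, ?_⟩, ?_, ?_⟩
  · have : Nonempty {x : LETS.StateVar H S // LETS.layer H S π x = ⟨0, hJ⟩} := ⟨⟨x₀, hx₀⟩⟩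
    exact Nat.card_pos
  · exact fun x y hy => LETS.layeredMatrix_eq_zero_of_first_layer hH hJ hy x
  · exact Nat.card_le_card_of_injective
      (fun y => ⟨y.1, LETS.layeredMatrix_eq_zero_of_first_layer hH hJ y.2⟩)
      fun y z h => Subtype.ext (Subtype.mk.inj h)
  · exact fun x hx y hy => hy (LETS.layeredMatrix_eq_zero hx y)
  · intro hirr
    have hconn := hM.transGen_of_stronglyConnected hA hℓ hirr.stronglyConnected
    have hne := hM.exists_adj hA hℓ hirr.stronglyConnected
    have hsc : LETS.StronglyConnected (LETS.removeSinks (LETS.digraph (LETS.layeredMatrix H S π))) :=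
      fun x y => (hconn x y).to_reflTransGen
    exact ⟨hsc, LETS.exists_isFrobeniusNormalForm (hM.nonneg hA) hne hsc,
      fun F hF => hF.existsUnique_block hne hconn⟩
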